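/- Let $d,k,N$ be natural numbers with $N\ge 1$. Let $T_{d,k}=\bigoplus_{\ell=0}^k(\mathbb R^d)^{\otimes \ell}$ be the truncated tensor algebra, with the tensor product in which all products of level greater than $k$ are set to $0$; for $\mathbf z\in T_{d,k}$ let $\mathbf z^{(\ell)}$ be its level-$\ell$ component. Let $\mathfrak g_{d,k}\subseteq T_{d,k}$ be the smallest Lie subalgebra (for the commutator bracket) containing the standard basis $e_1,\dots,e_d$ of $\mathbb R^d$, and let $\mathcal G_{d,k}=\exp(\mathfrak g_{d,k})\subseteq T_{d,k}$ be the free nilpotent Lie group, where $\exp(\mathbf z)=\sum_{\ell=0}^{k}\frac1{\ell!}\mathbf z^{\otimes\ell}$ and $\log(\mathbf s)=\sum_{\ell=1}^{k}\frac{(-1)^{\ell+1}}{\ell}(\mathbf s-1)^{\otimes\ell}$. A (Buser–Karcher) barycenter of a sample $\mathbf x=(\mathbf x_1,\dots,\mathbf x_N)\in\mathcal G_{d,k}^N$ is an element $\mathbf m\in\mathcal G_{d,k}$ with $\sum_{i=1}^N\log(\mathbf m^{-1}\mathbf x_i)=0$. Subsets of $T_{d,k}$ and $T_{d,k}^N$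 are viewed in real affine space through their tensor entries; an affine variety is the common zero set of a family of real polynomials, a morphism is the restriction of a polynomial map, and an isomorphism is a morphism with a two-sided inverse morphism. Then: 1. $\mathcal G_{d,k}$ is an affine variety, and every $\mathbf x\in\mathcal G_{d,k}^N$ has exactly one barycenter $\mathsf{bary}(\mathbf x)\in\mathcal G_{d,k}$. 2. The map $\mathsf{bary}:\mathcal G_{d,k}^N\to\mathcal G_{d,k}$ is given by a non-commutative polynomial: there is an element $q$ of the free associative algebra $\mathbb R\langle s_i^{(j)}\mid 1\le i\le N,\ 1\le j\le k\rangle$ such that, for all $\mathbf x\in\mathcal G_{d,k}^N$, $\mathsf{bary}(\mathbf x)$ is the element of $T_{d,k}$ obtained from $q$ by substituting $\mathbf x_i^{(j)}$ for $s_i^{(j)}$. 3. $\mathsf{bary}$ is a surjective morphism of affine varieties. 4. For every $i\in\{1,\dots,N\}$ and arbitrary fixed elements $\mathbf x_j\in\mathcal G_{d,k}$, $j\ne i$, the map $\mathcal G_{d,k}\to\mathcal G_{d,k}$, $\mathbf z\mapsto\mathsf{bary}(\mathbf x_1,\dots,\mathbf x_{i-1},\mathbf z,\mathbf x_{i+1},\dots,\mathbf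 x_N)$, is an isomorphism of affine varieties. In particular, for every $\mathbf y\in\mathcal G_{d,k}$ there is exactly one $\mathbf z$ for which this barycenter equals $\mathbf y$. -/

import Mathlib

/-- Words of length at most `k` in the letters `0, …, d - 1`. -/
abbrev Word (d k : ℕ) : Type := {w : List (Fin d) // w.length ≤ k}

/-- The truncated tensor algebra `⨁_{ℓ ≤ k} (ℝ^d)^{⊗ ℓ}`, a tensor sequence being given by its
entries: the entry at `(i₁, …, i_ℓ)` of the level-`ℓ` tensor is the value of `coeff` at the word
`i₁ … i_ℓ`. -/
@[ext]
structure TruncTensor (d k : ℕ) : Type where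
  /-- The tensor entries. -/
  coeff : Word d k → ℝ

namespace TruncTensor

variable {d k : ℕ}

/-! The vector space structure is entrywise. -/

instance : Zero (TruncTensor d k) := ⟨⟨0⟩⟩

noncomputable instance : Add (TruncTensor d k) := ⟨fun y z => ⟨y.coeff + z.coeff⟩⟩

noncomputable instance : Neg (TruncTensor d k) := ⟨fun y => ⟨-y.coeff⟩⟩

noncomputable instance : Sub (TruncTensor d k) := ⟨fun y z => ⟨y.coeff - z.coeff⟩⟩

noncomputable instance : SMul ℕ (TruncTensor d k) := ⟨fun n y => ⟨n • y.coeff⟩⟩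

noncomputable instance : SMul ℤ (TruncTensor d k) := ⟨fun n y => ⟨n • y.coeff⟩⟩

noncomputable instance : SMul ℝ (TruncTensor d k) := ⟨fun r y => ⟨r • y.coeff⟩⟩

theorem coeff_injective : Function.Injective (coeff : TruncTensor d k → Word d k → ℝ) :=
  fun _ _ h => TruncTensor.ext h

noncomputable instance : AddCommGroup (TruncTensor d k) :=
  coeff_injective.addCommGroup coeff rfl (fun _ _ => rfl) (fun _ => rfl) (fun _ _ => rfl)
    (fun _ _ => rfl) (fun _ _ => rfl)

/-- The tensor entries as an additive map. -/
def coeffHom (d k : ℕ) : TruncTensor d k →+ (Word d k → ℝ) where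
  toFun := coeff
  map_zero' := rfl
  map_add' _ _ := rfl

noncomputable instance : Module ℝ (TruncTensor d k) :=
  coeff_injective.module ℝ (coeffHom d k) (fun _ _ => rfl)

@[simp] theorem coeff_zero (w : Word d k) : (0 : TruncTensor d k).coeff w = 0 := rfl

@[simp] theorem coeff_add (y z : TruncTensor d k) (w : Word d k) :
    (y + z).coeff w = y.coeff w + z.coeff w := rfl

@[simp] theorem coeff_smul (r : ℝ) (y : TruncTensor d k) (w : Word d k) :
    (r • y).coeff w = r * y.coeff w := rfl

/-- The first `i` letters of a word. -/
def pre (w : Word d k) (i : ℕ) : Word d k :=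
  ⟨w.1.take i, (List.length_take_le' i w.1).trans w.2⟩

/-- The word without its first `i` letters. -/
def suf (w : Word d k) (i : ℕ) : Word d k :=
  ⟨w.1.drop i, (by rw [List.length_drop]; exact (Nat.sub_le _ _).trans w.2)⟩

/-- The truncated tensor product: an `ℓ`-tensor `a` and an `n`-tensor `b` with `ℓ + n ≤ k` have
the product with entries `a (i₁ … i_ℓ) * b (i_{ℓ+1} … i_{ℓ+n})`, extended bilinearly; products of
level greater than `k` are dropped. -/
noncomputable instance : Mul (TruncTensor d k) where
  mul y z := ⟨fun w =>
    ∑ i ∈ Finset.range (w.1.length + 1), y.coeff (pre w i) * z.coeff (suf w i)⟩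

/-- The unit, with `1` at level `0` and zero at all other levels. -/
instance : One (TruncTensor d k) where
  one := ⟨fun w => if w.1 = [] then 1 else 0⟩

theorem coeff_mul (y z : TruncTensor d k) (w : Word d k) :
    (y * z).coeff w =
      ∑ i ∈ Finset.range (w.1.length + 1), y.coeff (pre w i) * z.coeff (suf w i) := rfl

theorem coeff_one (w : Word d k) :
    (1 : TruncTensor d k).coeff w = if w.1 = [] then 1 else 0 := rfl

protected theorem one_mul' (y : TruncTensor d k) : 1 * y = y := by
  ext w : 2
  rw [coeff_mul, Finset.sum_eq_single 0]
  · have h : suf w 0 = w := Subtype.ext (by simp [suf])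
    simp [coeff_one, pre, h]
  · intro i hi h0
    have : (pre w i).1 ≠ [] := by
      simp only [pre, ne_eq, List.take_eq_nil_iff, not_or]
      refine ⟨h0, fun h => h0 ?_⟩
      simpa [h] using hi
    simp [coeff_one, this]
  · simp

protected theorem mul_one' (y : TruncTensor d k) : y * 1 = y := by
  ext w : 2
  rw [coeff_mul, Finset.sum_eq_single w.1.length]
  · have h : pre w w.1.length = w := Subtype.ext (by simp [pre])
    simp [coeff_one, suf, h]
  · intro i hi h0
    have : (suf w i).1 ≠ [] := by
      simp only [suf, ne_eq, List.drop_eq_nil_iff, not_le]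
      have := Finset.mem_range.1 hi
      omega
    simp [coeff_one, this]
  · simp

protected theorem mul_assoc' (x y z : TruncTensor d k) : x * y * z = x * (y * z) := by
  ext w : 2
  simp only [coeff_mul, Finset.sum_mul, Finset.mul_sum, Finset.sum_sigma']
  refine Finset.sum_bij' (fun p _ => ⟨p.2, p.1 - p.2⟩) (fun p _ => ⟨p.1 + p.2, p.1⟩) ?_ ?_ ?_ ?_ ?_
  · rintro ⟨i, j⟩ h
    simp [pre, suf] at h ⊢
    omega
  · rintro ⟨i, j⟩ h
    simp [pre, suf] at h ⊢
    omega
  · rintro ⟨i, j⟩ h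
    simp [pre] at h ⊢
    omega
  · rintro ⟨i, j⟩ h
    simp
  · rintro ⟨i, j⟩ h
    simp [pre] at h
    have hj : j ≤ i := by omega
    have e1 : pre (pre w i) j = pre w j :=
      Subtype.ext (by simp [pre, List.take_take, hj])
    have e2 : suf (pre w i) j = pre (suf w j) (i - j) :=
      Subtype.ext (by simp [pre, suf, List.drop_take])
    have e3 : suf (suf w j) (i - j) = suf w i :=
      Subtype.ext (by simp [suf, List.drop_drop, hj])
    simp only [e1, e2, e3, mul_assoc]

noncomputable instance : Ring (TruncTensor d k) :=
  { (inferInstance : AddCommGroup (TruncTensor d k)) with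
    mul := (· * ·)
    one := 1
    one_mul := TruncTensor.one_mul'
    mul_one := TruncTensor.mul_one'
    mul_assoc := TruncTensor.mul_assoc'
    zero_mul := fun y => by ext w : 2; simp [coeff_mul]
    mul_zero := fun y => by ext w : 2; simp [coeff_mul]
    left_distrib := fun x y z => by
      ext w : 2; simp [coeff_mul, mul_add, Finset.sum_add_distrib]
    right_distrib := fun x y z => by
      ext w : 2; simp [coeff_mul, add_mul, Finset.sum_add_distrib] }

noncomputable instance : Algebra ℝ (TruncTensor d k) :=
  Algebra.ofModule
    (fun r y z => by ext w : 2; simp [coeff_mul, Finset.mul_sum, mul_assoc])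
    (fun r y z => by ext w : 2; simp [coeff_mul, Finset.mul_sum, mul_left_comm])

/-- The Lie bracket is the commutator. -/
noncomputable instance : LieRing (TruncTensor d k) := LieRing.ofAssociativeRing

noncomputable instance : LieAlgebra ℝ (TruncTensor d k) := LieAlgebra.ofAssociativeAlgebra

/-- The standard basis vector `e_i` of `ℝ^d`, placed at level `1` (it is zero if `k = 0`). -/
def basisVec (d k : ℕ) (i : Fin d) : TruncTensor d k :=
  ⟨fun w => if w.1 = [i] then 1 else 0⟩

/-- The projection of a tensor sequence to its level-`ℓ` component. -/
def level (ℓ : ℕ) (y : TruncTensor d k) : TruncTensor d k :=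
  ⟨fun w => if w.1.length = ℓ then y.coeff w else 0⟩

/-- The exponential series. On tensor sequences without constant term, all powers beyond the
`k`-th vanish. -/
noncomputable def exp (z : TruncTensor d k) : TruncTensor d k :=
  ∑ ℓ ∈ Finset.range (k + 1), ((ℓ.factorial : ℝ)⁻¹) • z ^ ℓ

/-- The logarithm series. On tensor sequences with constant term `1`, all summands beyond the
`k`-th vanish. -/
noncomputable def log (s : TruncTensor d k) : TruncTensor d k :=
  ∑ ℓ ∈ Finset.Icc 1 k, ((-1 : ℝ) ^ (ℓ + 1) / (ℓ : ℝ)) • (s - 1) ^ ℓ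

end TruncTensor

/-- The free nilpotent Lie algebra: the smallest Lie subalgebra of the truncated tensor algebra
(with the commutator bracket) that contains the standard basis of `ℝ^d`. -/
noncomputable def freeNilpotentLieAlgebra (d k : ℕ) : LieSubalgebra ℝ (TruncTensor d k) :=
  LieSubalgebra.lieSpan ℝ (TruncTensor d k) (Set.range (TruncTensor.basisVec d k))

/-- The free nilpotent Lie group: the image of the free nilpotent Lie algebra under the
exponential. -/
def freeNilpotentLieGroup (d k : ℕ) : Set (TruncTensor d k) :=
  TruncTensor.exp '' (freeNilpotentLieAlgebra d k : Set (TruncTensor d k))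

instance (d k : ℕ) : Nonempty (freeNilpotentLieGroup d k) :=
  ⟨⟨TruncTensor.exp 0, 0, (freeNilpotentLieAlgebra d k).zero_mem, rfl⟩⟩

/-- `m` is a Buser–Karcher barycenter of the sample `x₁, …, x_N`: `∑ᵢ log (m⁻¹ xᵢ) = 0`. The
inverse is the one of the algebra (elements of the group are units there). -/
def IsBarycenter {d k N : ℕ} (x : Fin N → freeNilpotentLieGroup d k)
    (m : freeNilpotentLieGroup d k) : Prop :=
  ∑ i, TruncTensor.log (Ring.inverse (m : TruncTensor d k) * (x i : TruncTensor d k)) = 0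

/-- The barycenter map, selecting a solution of the barycenter equation. -/
noncomputable def bary {d k N : ℕ} (x : Fin N → freeNilpotentLieGroup d k) :
    freeNilpotentLieGroup d k :=
  Classical.epsilon (IsBarycenter x)

/-- The coordinates of an element of the free nilpotent Lie group: its tensor entries. -/
def groupCoord (d k : ℕ) (y : freeNilpotentLieGroup d k) : Word d k → ℝ :=
  y.1.coeff

/-- The coordinates of a point of the `N`-fold product of the free nilpotent Lie group. -/
def sampleCoord (d k N : ℕ) (x : Fin N → freeNilpotentLieGroup d k) : Fin N × Word d k → ℝ :=
  fun p => groupCoord d k (x p.1) p.2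

/-- A set of points in a real affine space is an affine variety: it is the set of common zeros of
a family of polynomials. -/
def IsAffineVariety {σ : Type*} (X : Set (σ → ℝ)) : Prop :=
  ∃ S : Set (MvPolynomial σ ℝ), X = {a | ∀ p ∈ S, MvPolynomial.eval a p = 0}

/-- `f : X → Y` is a morphism of affine varieties, where `X` and `Y` are embedded in affine spaces
by the coordinates `cX` and `cY`: it is the restriction of a polynomial map of the affine
spaces. -/
def IsVarietyMorphism {X Y σ τ : Type*} (cX : X → σ → ℝ) (cY : Y → τ → ℝ) (f : X → Y) : Prop :=
  ∃ P : τ → MvPolynomial σ ℝ, ∀ x t, cY (f x) t = MvPolynomial.eval (cX x) (P t)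

/-- `f : X → Y` is an isomorphism of affine varieties: a morphism with a two-sided inverse
morphism. -/
def IsVarietyIso {X Y σ τ : Type*} (cX : X → σ → ℝ) (cY : Y → τ → ℝ) (f : X → Y) : Prop :=
  IsVarietyMorphism cX cY f ∧
    ∃ g : Y → X, IsVarietyMorphism cY cX g ∧ Function.LeftInverse g f ∧ Function.RightInverse g f

/-- The non-commutative polynomials `ℝ⟨s₁, …, s_N⟩`, the free associative algebra in the symbols
`sᵢ⁽ʲ⁾` with `i ∈ [N]`, `j ∈ [k]`; the pair `(i, j)` with `j : Fin k` stands for `sᵢ⁽ʲ⁺¹⁾`. -/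
abbrev NCPoly (k N : ℕ) : Type := FreeAlgebra ℝ (Fin N × Fin k)

/-- The evaluation of a non-commutative polynomial at `N` tensor sequences: the algebra morphism
in the polynomial that replaces the symbol `sᵢ⁽ʲ⁾` by the level-`j` component of the `i`-th
tensor sequence. -/
noncomputable def ncEval {d k N : ℕ} (q : NCPoly k N) (z : Fin N → TruncTensor d k) :
    TruncTensor d k :=
  FreeAlgebra.lift ℝ (fun p : Fin N × Fin k => TruncTensor.level (p.2 + 1) (z p.1)) q

/-! Filter the algebra by lowest level. For `m` in the group and a Lie element `a` of level at least
`p`, replacing `m` by `m * exp a` changes the defect `∑ᵢ log (m⁻¹ xᵢ)` by `-N a` up to level `p + 1`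
(`baryDefect_mul_exp_sub_mem`). Taking `a` to be the defect divided by `N` pushes the defect up one
level, so `k` steps from `m = 1` reach a barycenter. The same estimate gives uniqueness: if `m` and
`m * exp a` both have defect zero, `a` climbs through all levels and vanishes.

The iteration is built from sums, products, `exp` and `log`, all truncated series. Hence its result
lies in every algebra of functions containing the inputs; suitable algebras give the non-commutative
polynomial and the morphism. With `y` and all but one `xⱼ` fixed, the barycenter equation is solved
for the remaining entry by `baryCompletion`, again polynomial, which yields the isomorphism and
surjectivity.

Closure of the group under products is proved without the Baker–Campbell–Hausdorff formula. With `E`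
the Euler derivation, an element `s` with constant term `1` lies in the group once `s⁻¹ E s` is a
Lie element (`mem_group_of_logDeriv_mem`), and this property passes to products. The group is a
variety because `exp (log s) = s` and `log s ∈ 𝔤` are polynomial conditions. -/

namespace TruncTensor

variable {d k : ℕ}

/-! ### The filtration by levels -/

/-- The tensor sequences whose components of level less than `p` vanish. -/
def levelGE (d k p : ℕ) : Submodule ℝ (TruncTensor d k) where
  carrier := {z | ∀ w : Word d k, w.1.length < p → z.coeff w = 0}
  add_mem' := fun ha hb w hw => by simp [ha w hw, hb w hw]
  zero_mem' := fun _ _ => rfl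
  smul_mem' := fun r z hz w hw => by simp [hz w hw]

theorem levelGE_anti {p q : ℕ} (h : p ≤ q) : levelGE d k q ≤ levelGE d k p :=
  fun _ hz w hw => hz w (hw.trans_le h)

theorem mem_levelGE_zero (z : TruncTensor d k) : z ∈ levelGE d k 0 :=
  fun _ hw => absurd hw (Nat.not_lt_zero _)

theorem eq_zero_of_mem_levelGE {p : ℕ} (hp : k < p) {z : TruncTensor d k}
    (hz : z ∈ levelGE d k p) : z = 0 := by
  ext w : 2
  exact hz w (w.2.trans_lt hp)

/-- Cutting a word shorter than `p + q` leaves a prefix shorter than `p` or a suffix shorter than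
`q`. -/
theorem mul_mem_levelGE {p q : ℕ} {y z : TruncTensor d k} (hy : y ∈ levelGE d k p)
    (hz : z ∈ levelGE d k q) : y * z ∈ levelGE d k (p + q) := by
  intro w hw
  rw [coeff_mul]
  refine Finset.sum_eq_zero fun i hi => ?_
  rcases lt_or_ge i p with h | h
  · rw [hy _ ((List.length_take_le i w.1).trans_lt h), zero_mul]
  · rw [hz (suf w i), mul_zero]
    have := Finset.mem_range.1 hi
    simp only [suf, List.length_drop]
    omega

theorem pow_mem_levelGE {z : TruncTensor d k} (hz : z ∈ levelGE d k 1) (n : ℕ) :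
    z ^ n ∈ levelGE d k n := by
  induction n with
  | zero => exact mem_levelGE_zero _
  | succ n ih => rw [pow_succ]; exact mul_mem_levelGE ih hz

theorem pow_eq_zero_of_mem_levelGE {z : TruncTensor d k} (hz : z ∈ levelGE d k 1) {n : ℕ}
    (hn : k < n) : z ^ n = 0 :=
  eq_zero_of_mem_levelGE hn (pow_mem_levelGE hz n)

theorem pow_sub_pow_mem_levelGE {p : ℕ} {a b : TruncTensor d k} (ha : a ∈ levelGE d k 1)
    (hb : b ∈ levelGE d k 1) (hab : a - b ∈ levelGE d k p) (n : ℕ) :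
    a ^ (n + 1) - b ^ (n + 1) ∈ levelGE d k (p + n) := by
  induction n with
  | zero => simpa using hab
  | succ n ih =>
    have e : a ^ (n + 1 + 1) - b ^ (n + 1 + 1) =
        a ^ (n + 1) * (a - b) + (a ^ (n + 1) - b ^ (n + 1)) * b := by
      rw [pow_succ a (n + 1), pow_succ b (n + 1)]
      noncomm_ring
    rw [e]
    refine add_mem ?_ ?_
    · have := mul_mem_levelGE (pow_mem_levelGE ha (n + 1)) hab
      rwa [add_comm] at this
    · have := mul_mem_levelGE ih hb
      rwa [add_assoc] at this

/-! ### Truncated power series -/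

/-- The truncated power series with coefficients `c`, evaluated at `z`. -/
noncomputable def series (c : ℕ → ℝ) (z : TruncTensor d k) : TruncTensor d k :=
  ∑ n ∈ Finset.range (k + 1), c n • z ^ n

theorem exp_eq_series (z : TruncTensor d k) :
    exp z = series (fun n => ((n.factorial : ℝ)⁻¹)) z := rfl

theorem log_eq_series (s : TruncTensor d k) :
    log s = series (fun n => (-1 : ℝ) ^ (n + 1) / (n : ℝ)) (s - 1) := by
  rw [log, series, Finset.range_eq_Ico, Finset.sum_eq_sum_Ico_succ_bot (Nat.succ_pos k)]
  -- The coefficient at `n = 0` is a division by zero, hence `0`, so no constant term is added.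
  simp only [Nat.cast_zero, div_zero, zero_smul, zero_add]
  rfl

/-- Only the linear term sees `a - b` at level `p`; in higher powers it is multiplied by further
factors of positive level. -/
theorem series_sub_series_mem {p : ℕ} (c : ℕ → ℝ) {a b : TruncTensor d k}
    (ha : a ∈ levelGE d k 1) (hb : b ∈ levelGE d k 1) (hab : a - b ∈ levelGE d k p) :
    series c a - series c b - c 1 • (a - b) ∈ levelGE d k (p + 1) := by
  rcases Nat.eq_zero_or_pos k with rfl | hk
  · have : a = b := by
      rw [eq_zero_of_mem_levelGE Nat.zero_lt_one ha, eq_zero_of_mem_levelGE Nat.zero_lt_one hb]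
    simp [this]
  obtain ⟨k, rfl⟩ : ∃ j, k = j + 1 := ⟨k - 1, by omega⟩
  have e : series c a - series c b - c 1 • (a - b) =
      ∑ n ∈ Finset.range k, c (n + 1 + 1) • (a ^ (n + 1 + 1) - b ^ (n + 1 + 1)) := by
    simp only [series]
    rw [← Finset.sum_sub_distrib, Finset.sum_range_succ', Finset.sum_range_succ']
    simp only [← smul_sub]
    simp
  rw [e]
  refine Submodule.sum_mem _ fun n _ => Submodule.smul_mem _ _ ?_
  exact levelGE_anti (by omega) (pow_sub_pow_mem_levelGE ha hb hab (n + 1))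

theorem series_sub_mem (c : ℕ → ℝ) {a : TruncTensor d k} (ha : a ∈ levelGE d k 1) :
    series c a - c 0 • 1 ∈ levelGE d k 1 := by
  have e : series c a - c 0 • 1 = ∑ n ∈ Finset.range k, c (n + 1) • a ^ (n + 1) := by
    rw [series, Finset.sum_range_succ']
    simp
  rw [e]
  exact Submodule.sum_mem _ fun n _ => Submodule.smul_mem _ _
    (levelGE_anti (by omega) (pow_mem_levelGE ha (n + 1)))

theorem exp_zero : exp (0 : TruncTensor d k) = 1 := by
  rw [exp, Finset.sum_range_succ']
  simp

theorem exp_sub_one_mem {z : TruncTensor d k} (hz : z ∈ levelGE d k 1) :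
    exp z - 1 ∈ levelGE d k 1 := by
  simpa [exp_eq_series] using series_sub_mem (fun n => ((n.factorial : ℝ)⁻¹)) hz

theorem exp_sub_exp_mem {p : ℕ} {a b : TruncTensor d k} (ha : a ∈ levelGE d k 1)
    (hb : b ∈ levelGE d k 1) (hab : a - b ∈ levelGE d k p) :
    exp a - exp b - (a - b) ∈ levelGE d k (p + 1) := by
  simpa [exp_eq_series] using series_sub_series_mem (fun n => ((n.factorial : ℝ)⁻¹)) ha hb hab

theorem log_sub_log_mem {p : ℕ} {s t : TruncTensor d k} (hs : s - 1 ∈ levelGE d k 1)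
    (ht : t - 1 ∈ levelGE d k 1) (hst : s - t ∈ levelGE d k p) :
    log s - log t - (s - t) ∈ levelGE d k (p + 1) := by
  simpa [log_eq_series] using
    series_sub_series_mem (fun n => (-1 : ℝ) ^ (n + 1) / (n : ℝ)) hs ht (by simpa using hst)

theorem mul_sub_one_mem {s t : TruncTensor d k} (hs : s - 1 ∈ levelGE d k 1)
    (ht : t - 1 ∈ levelGE d k 1) : s * t - 1 ∈ levelGE d k 1 := by
  have e : s * t - 1 = (s - 1) * (t - 1) + (s - 1) + (t - 1) := by noncomm_ring
  rw [e]
  exact add_mem (add_mem (levelGE_anti (by omega) (mul_mem_levelGE hs ht)) hs) ht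

end TruncTensor

/-! ### The logarithm inverts the exponential -/

section Polynomial

open Polynomial

/-- The truncated exponential series as a polynomial. -/
noncomputable def expPoly (k : ℕ) : ℝ[X] :=
  ∑ n ∈ Finset.range (k + 1), ((n.factorial : ℝ)⁻¹) • X ^ n

/-- The truncated logarithm series of the truncated exponential series. -/
noncomputable def logExpPoly (k : ℕ) : ℝ[X] :=
  ∑ n ∈ Finset.Icc 1 k, ((-1 : ℝ) ^ (n + 1) / (n : ℝ)) • (expPoly k - 1) ^ n

theorem X_dvd_expPoly_sub_one (k : ℕ) : X ∣ expPoly k - 1 := by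
  rw [expPoly, Finset.sum_range_succ']
  simp only [Nat.factorial_zero, Nat.cast_one, inv_one, pow_zero, one_smul, add_sub_cancel_right]
  exact Finset.dvd_sum fun n _ => dvd_smul_of_dvd _ (dvd_pow_self X (Nat.succ_ne_zero n))

theorem derivative_expPoly (k : ℕ) :
    derivative (expPoly k) = expPoly k - ((k.factorial : ℝ)⁻¹) • X ^ k := by
  rw [expPoly, Finset.sum_range_succ (n := k), add_sub_cancel_right, ← Finset.sum_range_succ,
    derivative_sum, Finset.sum_range_succ']
  simp only [derivative_smul, derivative_X_pow, Nat.factorial_zero, pow_zero, derivative_one,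
    smul_zero, add_zero]
  refine Finset.sum_congr rfl fun n _ => ?_
  rw [smul_eq_C_mul, smul_eq_C_mul, ← mul_assoc, ← C_mul, Nat.factorial_succ]
  congr 2
  have : (n.factorial : ℝ) ≠ 0 := by positivity
  push_cast
  field_simp

/-- Differentiation cancels the denominators, leaving a truncated geometric series for `1 / expPoly
k`. -/
theorem derivative_logExpPoly (k : ℕ) :
    derivative (logExpPoly k) =
      (∑ n ∈ Finset.range k, (1 - expPoly k) ^ n) * derivative (expPoly k) := by
  have hI : Finset.Icc 1 k = Finset.Ico 1 (k + 1) := rfl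
  rw [logExpPoly, hI, Finset.sum_Ico_eq_sum_range, Nat.add_sub_cancel, derivative_sum,
    Finset.sum_mul]
  refine Finset.sum_congr rfl fun n _ => ?_
  rw [derivative_smul, derivative_pow, smul_eq_C_mul, Nat.add_sub_cancel_left, ← mul_assoc,
    ← mul_assoc, ← C_mul, derivative_sub, derivative_one, sub_zero, ← neg_sub (expPoly k) 1,
    neg_pow (expPoly k - 1) n]
  congr 2
  have : (n : ℝ) + 1 ≠ 0 := by positivity
  have e : (-1 : ℝ) ^ (1 + n + 1) / ((1 + n : ℕ) : ℝ) * ((1 + n : ℕ) : ℝ) = (-1) ^ n := by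
    push_cast
    rw [add_comm (1 : ℝ), div_mul_cancel₀ _ this, add_comm 1 n, pow_succ, pow_succ]
    ring
  rw [e]
  simp

/-- Multiplied by `expPoly k`, which is coprime to `X ^ k`, the derivative of the difference becomes
divisible by `X ^ k`. Integrating gains one power, the constant term being checked separately. -/
theorem X_pow_dvd_logExpPoly_sub (k : ℕ) : X ^ (k + 1) ∣ logExpPoly k - X := by
  have hE := X_dvd_expPoly_sub_one k
  have hcop : IsCoprime (X ^ k) (expPoly k) := by
    obtain ⟨H, hH⟩ := hE
    exact IsCoprime.pow_left ⟨-H, 1, by rw [sub_eq_iff_eq_add.1 hH]; ring⟩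
  have hd : X ^ k ∣ derivative (logExpPoly k) - 1 := by
    refine hcop.dvd_of_dvd_mul_left ?_
    have e : expPoly k * (derivative (logExpPoly k) - 1) =
        -(((k.factorial : ℝ)⁻¹) • X ^ k) - (1 - expPoly k) ^ k * derivative (expPoly k) := by
      have h := mul_neg_geom_sum (1 - expPoly k) k
      rw [sub_sub_cancel] at h
      rw [mul_sub, derivative_logExpPoly, ← mul_assoc, h, derivative_expPoly]
      ring
    rw [e]
    refine dvd_sub (Dvd.dvd.neg_right (dvd_smul_of_dvd _ dvd_rfl)) (Dvd.dvd.mul_right ?_ _)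
    exact pow_dvd_pow_of_dvd (by rw [← neg_sub]; exact hE.neg_right) k
  rw [X_pow_dvd_iff] at hd ⊢
  intro n hn
  cases n with
  | zero =>
    have : X ∣ logExpPoly k - X := by
      refine dvd_sub (Finset.dvd_sum fun n hn => dvd_smul_of_dvd _ ?_) dvd_rfl
      exact dvd_pow hE (by have := (Finset.mem_Icc.1 hn).1; omega)
    exact X_dvd_iff.1 this
  | succ n =>
    have h := hd n (by omega)
    have e : derivative (logExpPoly k) - 1 = derivative (logExpPoly k - X) := by simp
    rw [e, coeff_derivative] at h
    exact (mul_eq_zero.1 h).resolve_right (by positivity)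

theorem TruncTensor.log_exp {d k : ℕ} {z : TruncTensor d k} (hz : z ∈ levelGE d k 1) :
    log (exp z) = z := by
  obtain ⟨Q, hQ⟩ := X_pow_dvd_logExpPoly_sub k
  have h := congrArg (aeval z) hQ
  simp only [map_sub, map_mul, map_pow, aeval_X, pow_eq_zero_of_mem_levelGE hz (Nat.lt_succ_self k),
    zero_mul, logExpPoly, expPoly, map_sum, map_smul, map_one] at h
  exact sub_eq_zero.1 h

end Polynomial

/-! ### Conjugation by an exponential -/

section Conjugation

variable {A : Type*} [Ring A] [Algebra ℚ A]

/-- The conjugate `exp (-z) * y * exp z` is a combination of iterated commutators with `z`. -/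
theorem IsNilpotent.exists_exp_neg_mul_mul_exp_eq_sum {z : A} (hz : IsNilpotent z) (y : A) :
    ∃ M : ℕ, IsNilpotent.exp (-z) * y * IsNilpotent.exp z =
      ∑ n ∈ Finset.range M, (n.factorial : ℚ)⁻¹ • (fun w => ⁅w, z⁆)^[n] y := by
  -- `L` and `R` commute and `L + R` is `w ↦ ⁅w, z⁆`, so `exp L * exp R = exp (L + R)` is the claim.
  let L : A →ₗ[ℚ] A := LinearMap.mulLeft ℚ (-z)
  let R : A →ₗ[ℚ] A := LinearMap.mulRight ℚ z
  obtain ⟨m, hm⟩ := hz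
  have hm' : (-z) ^ m = 0 := by rw [neg_pow, hm, mul_zero]
  have hL : L ^ m = 0 := by simp [L, LinearMap.pow_mulLeft, hm']
  have hR : R ^ m = 0 := by simp [R, LinearMap.pow_mulRight, hm]
  have hc : Commute L R := LinearMap.commute_mulLeft_right _ _
  obtain ⟨M, hM⟩ := hc.isNilpotent_add ⟨m, hL⟩ ⟨m, hR⟩
  have hadd := IsNilpotent.exp_add_of_commute hc ⟨m, hL⟩ ⟨m, hR⟩
  have e1 : IsNilpotent.exp L (IsNilpotent.exp R y) =
      IsNilpotent.exp (-z) * y * IsNilpotent.exp z := by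
    rw [IsNilpotent.exp_eq_sum hL, IsNilpotent.exp_eq_sum hR, IsNilpotent.exp_eq_sum hm,
      IsNilpotent.exp_eq_sum hm']
    simp [L, R, LinearMap.pow_mulLeft, LinearMap.pow_mulRight, Finset.sum_mul, Finset.mul_sum,
      mul_assoc]
  have e2 : ∀ n, ((L + R) ^ n) y = (fun w => ⁅w, z⁆)^[n] y := by
    intro n
    rw [Module.End.pow_apply]
    congr 1
    ext w
    simp [L, R, Ring.lie_def, sub_eq_neg_add]
  refine ⟨M, ?_⟩
  rw [← e1, ← Module.End.mul_apply, ← hadd, IsNilpotent.exp_eq_sum hM]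
  simp [e2]

end Conjugation

namespace TruncTensor

variable {d k : ℕ}

/-- Needed to use the results on `IsNilpotent.exp`, which are stated over `ℚ`. -/
noncomputable instance : Algebra ℚ (TruncTensor d k) :=
  Algebra.compHom (TruncTensor d k) (algebraMap ℚ ℝ)

theorem rat_smul_eq (q : ℚ) (z : TruncTensor d k) : q • z = (q : ℝ) • z := rfl

theorem exp_eq_nilpotent_exp {z : TruncTensor d k} (hz : z ∈ levelGE d k 1) :
    exp z = IsNilpotent.exp z := by
  rw [IsNilpotent.exp_eq_sum (pow_eq_zero_of_mem_levelGE hz (Nat.lt_succ_self k)), exp]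
  simp [rat_smul_eq]

theorem isNilpotent_of_mem_levelGE {z : TruncTensor d k} (hz : z ∈ levelGE d k 1) :
    IsNilpotent z := ⟨k + 1, pow_eq_zero_of_mem_levelGE hz (Nat.lt_succ_self k)⟩

theorem exp_mul_exp_neg {z : TruncTensor d k} (hz : z ∈ levelGE d k 1) :
    exp z * exp (-z) = 1 := by
  rw [exp_eq_nilpotent_exp hz, exp_eq_nilpotent_exp (neg_mem hz),
    IsNilpotent.exp_mul_exp_neg_self (isNilpotent_of_mem_levelGE hz)]

theorem exp_neg_mul_exp {z : TruncTensor d k} (hz : z ∈ levelGE d k 1) :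
    exp (-z) * exp z = 1 := by
  simpa using exp_mul_exp_neg (neg_mem hz)

theorem inverse_exp {z : TruncTensor d k} (hz : z ∈ levelGE d k 1) :
    Ring.inverse (exp z) = exp (-z) :=
  Ring.inverse_unit (⟨exp z, exp (-z), exp_mul_exp_neg hz, exp_neg_mul_exp hz⟩ : (TruncTensor d k)ˣ)

/-! ### The Euler derivation -/

/-- The derivation that multiplies the component of level `ℓ` by `ℓ`. -/
noncomputable def euler (d k : ℕ) : TruncTensor d k →ₗ[ℝ] TruncTensor d k where
  toFun z := ⟨fun w => w.1.length * z.coeff w⟩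
  map_add' y z := by ext w : 2; simp [mul_add]
  map_smul' r z := by ext w : 2; simp [mul_left_comm]

theorem coeff_euler (z : TruncTensor d k) (w : Word d k) :
    (euler d k z).coeff w = w.1.length * z.coeff w := rfl

theorem euler_mul (y z : TruncTensor d k) :
    euler d k (y * z) = euler d k y * z + y * euler d k z := by
  ext w : 2
  simp only [coeff_add, coeff_mul, coeff_euler, Finset.mul_sum, ← Finset.sum_add_distrib]
  refine Finset.sum_congr rfl fun i hi => ?_
  have hi' := Finset.mem_range.1 hi
  have e : (w.1.length : ℝ) = (pre w i).1.length + (suf w i).1.length := by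
    rw [← Nat.cast_add]
    congr 1
    simp only [pre, suf, List.length_take, List.length_drop]
    omega
  rw [e]
  ring

theorem euler_one : euler d k 1 = 0 := by
  ext w : 2
  rw [coeff_euler, coeff_one]
  split_ifs with h <;> simp [h]

theorem euler_basisVec (i : Fin d) : euler d k (basisVec d k i) = basisVec d k i := by
  ext w : 2
  rw [coeff_euler, basisVec]
  dsimp only
  split_ifs with h <;> simp [h]

theorem euler_mem_levelGE {p : ℕ} {z : TruncTensor d k} (hz : z ∈ levelGE d k p) :
    euler d k z ∈ levelGE d k p := fun w hw => by rw [coeff_euler, hz w hw, mul_zero]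

/-- For `p > 0` this makes the Euler derivation invertible on leading terms. -/
theorem euler_sub_smul_mem {p : ℕ} {z : TruncTensor d k} (hz : z ∈ levelGE d k p) :
    euler d k z - (p : ℝ) • z ∈ levelGE d k (p + 1) := by
  intro w hw
  rw [sub_eq_add_neg, ← neg_smul, coeff_add, coeff_euler, coeff_smul]
  rcases (Nat.lt_succ_iff.1 hw).lt_or_eq with h | h
  · simp [hz w h]
  · rw [h]; ring

/-! ### The free nilpotent Lie algebra -/

theorem lieAlgebra_le_levelGE {z : TruncTensor d k} (hz : z ∈ freeNilpotentLieAlgebra d k) :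
    z ∈ levelGE d k 1 := by
  induction hz using LieSubalgebra.lieSpan_induction with
  | mem x h =>
    obtain ⟨i, rfl⟩ := h
    intro w hw
    have : w.1 = [] := List.length_eq_zero_iff.1 (by omega)
    simp [basisVec, this]
  | zero => exact zero_mem _
  | add x y _ _ hx hy => exact add_mem hx hy
  | smul a x _ hx => exact Submodule.smul_mem _ _ hx
  | lie x y _ _ hx hy =>
    rw [Ring.lie_def]
    exact levelGE_anti (by omega) (sub_mem (mul_mem_levelGE hx hy) (mul_mem_levelGE hy hx))

/-- A derivation of the bracket that fixes the generators preserves the Lie algebra they span. -/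
theorem euler_mem_lieAlgebra {z : TruncTensor d k} (hz : z ∈ freeNilpotentLieAlgebra d k) :
    euler d k z ∈ freeNilpotentLieAlgebra d k := by
  induction hz using LieSubalgebra.lieSpan_induction with
  | mem x h =>
    obtain ⟨i, rfl⟩ := h
    rw [euler_basisVec]
    exact LieSubalgebra.subset_lieSpan ⟨i, rfl⟩
  | zero => rw [map_zero]; exact zero_mem _
  | add x y _ _ hx hy => rw [map_add]; exact add_mem hx hy
  | smul a x _ hx => rw [map_smul]; exact LieSubalgebra.smul_mem _ _ hx
  | lie x y hx hy hx' hy' =>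
    have e : euler d k ⁅x, y⁆ = ⁅euler d k x, y⁆ + ⁅x, euler d k y⁆ := by
      simp only [Ring.lie_def, map_sub, euler_mul]
      abel
    rw [e]
    exact add_mem (LieSubalgebra.lie_mem _ hx' hy) (LieSubalgebra.lie_mem _ hx hy')

theorem iterate_lie_mem {y z : TruncTensor d k} (hy : y ∈ freeNilpotentLieAlgebra d k)
    (hz : z ∈ freeNilpotentLieAlgebra d k) (n : ℕ) :
    (fun w => ⁅w, z⁆)^[n] y ∈ freeNilpotentLieAlgebra d k := by
  induction n with
  | zero => exact hy
  | succ n ih =>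
    rw [Function.iterate_succ_apply']
    exact LieSubalgebra.lie_mem _ ih hz

theorem exp_neg_mul_mul_exp_mem {y z : TruncTensor d k} (hy : y ∈ freeNilpotentLieAlgebra d k)
    (hz : z ∈ freeNilpotentLieAlgebra d k) :
    exp (-z) * y * exp z ∈ freeNilpotentLieAlgebra d k := by
  have hz1 := lieAlgebra_le_levelGE hz
  obtain ⟨M, hM⟩ := (isNilpotent_of_mem_levelGE hz1).exists_exp_neg_mul_mul_exp_eq_sum y
  rw [exp_eq_nilpotent_exp hz1, exp_eq_nilpotent_exp (neg_mem hz1), hM]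
  exact sum_mem fun n _ => LieSubalgebra.smul_mem _ _ (iterate_lie_mem hy hz n)

/-- The logarithmic derivative of an exponential, obtained by conjugating the Euler derivation
with a left multiplication in the algebra of additive endomorphisms. -/
theorem exp_neg_mul_euler_exp_mem {z : TruncTensor d k} (hz : z ∈ freeNilpotentLieAlgebra d k) :
    exp (-z) * euler d k (exp z) ∈ freeNilpotentLieAlgebra d k := by
  have hz1 := lieAlgebra_le_levelGE hz
  have hnil := isNilpotent_of_mem_levelGE hz1
  let Λ : TruncTensor d k →ₐ[ℚ] Module.End ℚ (TruncTensor d k) := Algebra.lmul ℚ _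
  let D : Module.End ℚ (TruncTensor d k) :=
    { toFun := euler d k
      map_add' := map_add _
      map_smul' := fun q y => by
        simp only [rat_smul_eq, map_smul, eq_ratCast, Rat.cast_id] }
  -- By the Leibniz rule, every iterated commutator after the zeroth is left multiplication by a Lie
  -- element.
  have hD : ⁅D, Λ z⁆ = Λ (euler d k z) := by
    ext y : 1
    have : euler d k (z * y) - z * euler d k y = euler d k z * y := by
      rw [euler_mul]; abel
    simpa [Ring.lie_def, Λ, D] using this
  have hiter : ∀ n, (fun w => ⁅w, Λ z⁆)^[n + 1] D = Λ ((fun w => ⁅w, z⁆)^[n] (euler d k z)) := by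
    intro n
    rw [Function.iterate_succ_apply, hD]
    induction n with
    | zero => rfl
    | succ n ih =>
      rw [Function.iterate_succ_apply', Function.iterate_succ_apply', ih]
      simp [Ring.lie_def]
  obtain ⟨M, hM⟩ := (hnil.map Λ).exists_exp_neg_mul_mul_exp_eq_sum D
  rw [← map_neg, ← IsNilpotent.map_exp hnil.neg, ← IsNilpotent.map_exp hnil] at hM
  -- Evaluation at `1` recovers those Lie elements and kills the zeroth term, as `D 1 = 0`.
  have h1 := LinearMap.congr_fun hM 1
  have e : (Λ (IsNilpotent.exp (-z)) * D * Λ (IsNilpotent.exp z)) 1 =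
      exp (-z) * euler d k (exp z) := by
    rw [exp_eq_nilpotent_exp hz1, exp_eq_nilpotent_exp (neg_mem hz1)]
    simp [Λ, D]
  rw [← e, h1, LinearMap.sum_apply]
  refine sum_mem fun n _ => LieSubalgebra.smul_mem _ _ ?_
  cases n with
  | zero =>
    have : D 1 = 0 := euler_one
    simp only [Function.iterate_zero, id, this]
    exact zero_mem _
  | succ n =>
    rw [hiter]
    simpa [Λ] using iterate_lie_mem (euler_mem_lieAlgebra hz) hz n

/-! ### The free nilpotent Lie group -/

theorem sub_one_mem_of_mem_group {s : TruncTensor d k} (hs : s ∈ freeNilpotentLieGroup d k) :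
    s - 1 ∈ levelGE d k 1 := by
  obtain ⟨z, hz, rfl⟩ := hs
  exact exp_sub_one_mem (lieAlgebra_le_levelGE hz)

theorem log_mem_lieAlgebra {s : TruncTensor d k} (hs : s ∈ freeNilpotentLieGroup d k) :
    log s ∈ freeNilpotentLieAlgebra d k := by
  obtain ⟨z, hz, rfl⟩ := hs
  rwa [log_exp (lieAlgebra_le_levelGE hz)]

theorem exp_log_of_mem_group {s : TruncTensor d k} (hs : s ∈ freeNilpotentLieGroup d k) :
    exp (log s) = s := by
  obtain ⟨z, hz, rfl⟩ := hs
  rw [log_exp (lieAlgebra_le_levelGE hz)]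

/-- An element with constant term `1` whose logarithmic derivative is a Lie element lies in the
group. -/
theorem mem_group_of_logDeriv_mem {s t : TruncTensor d k} (hs : s - 1 ∈ levelGE d k 1)
    (ht : t - 1 ∈ levelGE d k 1) (hts : t * s = 1)
    (h : t * euler d k s ∈ freeNilpotentLieAlgebra d k) : s ∈ freeNilpotentLieGroup d k := by
  -- Exponentials of Lie elements approximate `s` level by level; `p = k` is exact.
  have key : ∀ p : ℕ, ∃ z ∈ freeNilpotentLieAlgebra d k, s - exp z ∈ levelGE d k (p + 1) := by
    intro p
    induction p with
    | zero => exact ⟨0, zero_mem _, by rwa [exp_zero, zero_add]⟩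
    | succ p ih =>
      obtain ⟨z, hz, hr⟩ := ih
      set r := s - exp z with hrdef
      have hz1 := lieAlgebra_le_levelGE hz
      have hp : ((p + 1 : ℕ) : ℝ) ≠ 0 := by positivity
      -- the difference of the logarithmic derivatives is `euler r` up to higher levels
      have e1 : t * euler d k s - exp (-z) * euler d k (exp z) - euler d k r =
          (t - 1) * euler d k r - (t * r) * (exp (-z) * euler d k (exp z)) := by
        have : t * r = 1 - t * exp z := by rw [hrdef, mul_sub, hts]
        rw [this, sub_mul (1 : TruncTensor d k), one_mul, mul_assoc t, ← mul_assoc (exp z),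
          exp_mul_exp_neg hz1, one_mul, hrdef, map_sub]
        noncomm_ring
      have hlz := exp_neg_mul_euler_exp_mem hz
      have m1 : t * euler d k s - exp (-z) * euler d k (exp z) - euler d k r ∈
          levelGE d k (p + 1 + 1) := by
        rw [e1]
        refine sub_mem ?_ ?_
        · exact levelGE_anti (by omega) (mul_mem_levelGE ht (euler_mem_levelGE hr))
        · have := mul_mem_levelGE (mem_levelGE_zero t) hr
          rw [zero_add] at this
          exact mul_mem_levelGE this (lieAlgebra_le_levelGE hlz)
      -- On the leading level `p + 1` of `r` the Euler derivation is the scalar `p + 1`. So `r'`, a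
      -- Lie element, has the same leading term as the error `r` and can correct `z`.
      set r' := ((p + 1 : ℕ) : ℝ)⁻¹ • (t * euler d k s - exp (-z) * euler d k (exp z))
      have hr'g : r' ∈ freeNilpotentLieAlgebra d k :=
        LieSubalgebra.smul_mem _ _ (sub_mem h hlz)
      have m2 : r' - r ∈ levelGE d k (p + 1 + 1) := by
        have := Submodule.smul_mem _ (((p + 1 : ℕ) : ℝ)⁻¹) (add_mem m1 (euler_sub_smul_mem hr))
        convert this using 1
        rw [sub_add_sub_cancel, smul_sub, smul_smul, inv_mul_cancel₀ hp, one_smul]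
      have m3 : r' ∈ levelGE d k (p + 1) := by
        have := add_mem (levelGE_anti (Nat.le_succ _) m2) hr
        rwa [sub_add_cancel] at this
      refine ⟨z + r', add_mem hz hr'g, ?_⟩
      have m4 := exp_sub_exp_mem (p := p + 1) (lieAlgebra_le_levelGE (add_mem hz hr'g)) hz1
        (by rwa [add_sub_cancel_left])
      have e2 : s - exp (z + r') = -(r' - r) - (exp (z + r') - exp z - (z + r' - z)) := by
        rw [hrdef]; abel
      rw [e2]
      exact sub_mem (neg_mem m2) m4
  obtain ⟨z, hz, hr⟩ := key k
  exact ⟨z, hz, (sub_eq_zero.1 (eq_zero_of_mem_levelGE (Nat.lt_succ_self k) hr)).symm⟩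

/-- The logarithmic derivative of `s * t` is that of `s` conjugated by `t`, plus that of `t`;
conjugation preserves Lie elements. -/
theorem mul_mem_group {s t : TruncTensor d k} (hs : s ∈ freeNilpotentLieGroup d k)
    (ht : t ∈ freeNilpotentLieGroup d k) : s * t ∈ freeNilpotentLieGroup d k := by
  obtain ⟨y, hy, rfl⟩ := hs
  obtain ⟨z, hz, rfl⟩ := ht
  have hy1 := lieAlgebra_le_levelGE hy
  have hz1 := lieAlgebra_le_levelGE hz
  refine mem_group_of_logDeriv_mem (t := exp (-z) * exp (-y))
    (mul_sub_one_mem (exp_sub_one_mem hy1) (exp_sub_one_mem hz1))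
    (mul_sub_one_mem (exp_sub_one_mem (neg_mem hz1)) (exp_sub_one_mem (neg_mem hy1))) ?_ ?_
  · rw [mul_assoc, ← mul_assoc (exp (-y)), exp_neg_mul_exp hy1, one_mul, exp_neg_mul_exp hz1]
  · have e : exp (-z) * exp (-y) * euler d k (exp y * exp z) =
        exp (-z) * (exp (-y) * euler d k (exp y)) * exp z + exp (-z) * euler d k (exp z) := by
      have : exp (-z) * exp (-y) * (exp y * euler d k (exp z)) = exp (-z) * euler d k (exp z) := by
        rw [mul_assoc, ← mul_assoc (exp (-y)), exp_neg_mul_exp hy1, one_mul]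
      rw [euler_mul, mul_add, this]
      simp only [mul_assoc]
    rw [e]
    exact add_mem (exp_neg_mul_mul_exp_mem (exp_neg_mul_euler_exp_mem hy) hz)
      (exp_neg_mul_euler_exp_mem hz)

theorem inverse_mem_group {s : TruncTensor d k} (hs : s ∈ freeNilpotentLieGroup d k) :
    Ring.inverse s ∈ freeNilpotentLieGroup d k := by
  obtain ⟨z, hz, rfl⟩ := hs
  rw [inverse_exp (lieAlgebra_le_levelGE hz)]
  exact ⟨-z, neg_mem hz, rfl⟩

/-- Replaces the inverse by a polynomial expression in `s`. -/
theorem inverse_eq_exp_neg_log {s : TruncTensor d k} (hs : s ∈ freeNilpotentLieGroup d k) :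
    Ring.inverse s = exp (-log s) := by
  obtain ⟨z, hz, rfl⟩ := hs
  rw [inverse_exp (lieAlgebra_le_levelGE hz), log_exp (lieAlgebra_le_levelGE hz)]

theorem isUnit_of_mem_group {s : TruncTensor d k} (hs : s ∈ freeNilpotentLieGroup d k) :
    IsUnit s := by
  obtain ⟨z, hz, rfl⟩ := hs
  exact ⟨⟨exp z, exp (-z), exp_mul_exp_neg (lieAlgebra_le_levelGE hz),
    exp_neg_mul_exp (lieAlgebra_le_levelGE hz)⟩, rfl⟩

theorem inverse_mul_mem_group {s t : TruncTensor d k} (hs : s ∈ freeNilpotentLieGroup d k)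
    (ht : t ∈ freeNilpotentLieGroup d k) : Ring.inverse s * t ∈ freeNilpotentLieGroup d k :=
  mul_mem_group (inverse_mem_group hs) ht

end TruncTensor

namespace TruncTensor

variable {d k N : ℕ}

/-! ### Existence and uniqueness of the barycenter -/

theorem inverse_mul_rev {s t : TruncTensor d k} (hs : IsUnit s) (ht : IsUnit t) :
    Ring.inverse (s * t) = Ring.inverse t * Ring.inverse s := by
  obtain ⟨u, rfl⟩ := hs
  obtain ⟨v, rfl⟩ := ht
  rw [← Units.val_mul, Ring.inverse_unit, Ring.inverse_unit, Ring.inverse_unit, mul_inv_rev,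
    Units.val_mul]

/-- Modulo level `p + 1`, `exp (-a) * s` is `s - a`, since `a * (s - 1)` is negligible; `log`
preserves leading differences. -/
theorem log_exp_neg_mul_sub_mem {p : ℕ} {a s : TruncTensor d k} (ha : a ∈ levelGE d k 1)
    (hap : a ∈ levelGE d k p) (hs : s - 1 ∈ levelGE d k 1) :
    log (exp (-a) * s) - (log s - a) ∈ levelGE d k (p + 1) := by
  have h1 : exp (-a) - 1 + a ∈ levelGE d k (p + 1) := by
    have := exp_sub_exp_mem (p := p) (neg_mem ha) (zero_mem (levelGE d k 1))
      (by rw [sub_zero]; exact neg_mem hap)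
    rwa [exp_zero, sub_zero, sub_neg_eq_add] at this
  have h2 : exp (-a) * s - s + a ∈ levelGE d k (p + 1) := by
    have e : exp (-a) * s - s + a = (exp (-a) - 1 + a) * s - a * (s - 1) := by noncomm_ring
    rw [e]
    exact sub_mem (mul_mem_levelGE (q := 0) h1 (mem_levelGE_zero s)) (mul_mem_levelGE hap hs)
  have h3 : exp (-a) * s - s ∈ levelGE d k p := by
    have := sub_mem (levelGE_anti (Nat.le_succ p) h2) hap
    rwa [add_sub_cancel_right] at this
  have h4 := log_sub_log_mem (mul_sub_one_mem (exp_sub_one_mem (neg_mem ha)) hs) hs h3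
  have e : log (exp (-a) * s) - (log s - a) =
      log (exp (-a) * s) - log s - (exp (-a) * s - s) + (exp (-a) * s - s + a) := by abel
  rw [e]
  exact add_mem h4 h2

/-- The left-hand side of the barycenter equation. -/
noncomputable def baryDefect (x : Fin N → TruncTensor d k) (m : TruncTensor d k) :
    TruncTensor d k :=
  ∑ i, log (Ring.inverse m * x i)

theorem baryDefect_mem_lieAlgebra {x : Fin N → TruncTensor d k} {m : TruncTensor d k}
    (hx : ∀ i, x i ∈ freeNilpotentLieGroup d k) (hm : m ∈ freeNilpotentLieGroup d k) :
    baryDefect x m ∈ freeNilpotentLieAlgebra d k :=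
  sum_mem fun i _ => log_mem_lieAlgebra (inverse_mul_mem_group hm (hx i))

theorem baryDefect_mul_exp_sub_mem {p : ℕ} {x : Fin N → TruncTensor d k} {m a : TruncTensor d k}
    (hx : ∀ i, x i ∈ freeNilpotentLieGroup d k) (hm : m ∈ freeNilpotentLieGroup d k)
    (ha : a ∈ freeNilpotentLieAlgebra d k) (hap : a ∈ levelGE d k p) :
    baryDefect x (m * exp a) - (baryDefect x m - (N : ℝ) • a) ∈ levelGE d k (p + 1) := by
  have ha1 := lieAlgebra_le_levelGE ha
  have hN : (N : ℝ) • a = ∑ _i : Fin N, a := by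
    simp [Nat.cast_smul_eq_nsmul]
  rw [hN, baryDefect, baryDefect, ← Finset.sum_sub_distrib, ← Finset.sum_sub_distrib]
  refine Submodule.sum_mem _ fun i _ => ?_
  rw [inverse_mul_rev (isUnit_of_mem_group hm) (isUnit_of_mem_group ⟨a, ha, rfl⟩),
    inverse_exp ha1, mul_assoc]
  exact log_exp_neg_mul_sub_mem ha1 hap
    (sub_one_mem_of_mem_group (inverse_mul_mem_group hm (hx i)))

/-- One step of the iteration that converges to the barycenter. On the group, `exp (-log m)` is
the inverse of `m`. -/
noncomputable def baryStep (x : Fin N → TruncTensor d k) (m : TruncTensor d k) :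
    TruncTensor d k :=
  m * exp ((N : ℝ)⁻¹ • ∑ i, log (exp (-log m) * x i))

/-- The barycenter, reached after `k` steps of the iteration. -/
noncomputable def baryIterate (x : Fin N → TruncTensor d k) : TruncTensor d k :=
  (baryStep x)^[k] 1

theorem baryStep_eq (x : Fin N → TruncTensor d k) {m : TruncTensor d k}
    (hm : m ∈ freeNilpotentLieGroup d k) :
    baryStep x m = m * exp ((N : ℝ)⁻¹ • baryDefect x m) := by
  rw [baryStep, baryDefect, inverse_eq_exp_neg_log hm]

theorem one_mem_group : (1 : TruncTensor d k) ∈ freeNilpotentLieGroup d k :=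
  ⟨0, zero_mem _, exp_zero⟩

theorem baryStep_iterate_mem (hN : 1 ≤ N) {x : Fin N → TruncTensor d k}
    (hx : ∀ i, x i ∈ freeNilpotentLieGroup d k) (n : ℕ) :
    (baryStep x)^[n] 1 ∈ freeNilpotentLieGroup d k ∧
      baryDefect x ((baryStep x)^[n] 1) ∈ levelGE d k (n + 1) := by
  induction n with
  | zero =>
    exact ⟨one_mem_group, lieAlgebra_le_levelGE (baryDefect_mem_lieAlgebra hx one_mem_group)⟩
  | succ n ih =>
    obtain ⟨hm, hd⟩ := ih
    rw [Function.iterate_succ_apply', baryStep_eq x hm]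
    set m := (baryStep x)^[n] 1
    -- The factor `N⁻¹` makes the first-order change cancel the defect.
    have ha : (N : ℝ)⁻¹ • baryDefect x m ∈ freeNilpotentLieAlgebra d k :=
      LieSubalgebra.smul_mem _ _ (baryDefect_mem_lieAlgebra hx hm)
    refine ⟨mul_mem_group hm ⟨_, ha, rfl⟩, ?_⟩
    have h := baryDefect_mul_exp_sub_mem hx hm ha (Submodule.smul_mem _ _ hd)
    have hN' : (N : ℝ) ≠ 0 := by positivity
    rwa [smul_smul, mul_inv_cancel₀ hN', one_smul, sub_self, sub_zero] at h

theorem baryIterate_mem (hN : 1 ≤ N) {x : Fin N → TruncTensor d k}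
    (hx : ∀ i, x i ∈ freeNilpotentLieGroup d k) : baryIterate x ∈ freeNilpotentLieGroup d k :=
  (baryStep_iterate_mem hN hx k).1

theorem baryDefect_baryIterate (hN : 1 ≤ N) {x : Fin N → TruncTensor d k}
    (hx : ∀ i, x i ∈ freeNilpotentLieGroup d k) : baryDefect x (baryIterate x) = 0 :=
  eq_zero_of_mem_levelGE (Nat.lt_succ_self k) (baryStep_iterate_mem hN hx k).2

theorem eq_of_baryDefect_eq_zero (hN : 1 ≤ N) {x : Fin N → TruncTensor d k}
    (hx : ∀ i, x i ∈ freeNilpotentLieGroup d k) {m m' : TruncTensor d k}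
    (hm : m ∈ freeNilpotentLieGroup d k) (hm' : m' ∈ freeNilpotentLieGroup d k)
    (h : baryDefect x m = 0) (h' : baryDefect x m' = 0) : m' = m := by
  have hq := inverse_mul_mem_group hm hm'
  obtain ⟨a, ha, hae⟩ := hq
  have hm'e : m' = m * exp a := by
    rw [hae, ← mul_assoc, Ring.mul_inverse_cancel _ (isUnit_of_mem_group hm), one_mul]
  -- Both defects vanish, so the estimate leaves `N • a` alone, one level higher than `a` was known
  -- to be.
  have key : ∀ p, a ∈ levelGE d k p := by
    intro p
    induction p with
    | zero => exact mem_levelGE_zero a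
    | succ p ih =>
      have := baryDefect_mul_exp_sub_mem hx hm ha ih
      rw [← hm'e, h, h', zero_sub, zero_sub, neg_neg] at this
      have hN' : (N : ℝ) ≠ 0 := by positivity
      have := Submodule.smul_mem _ ((N : ℝ)⁻¹) this
      rwa [smul_smul, inv_mul_cancel₀ hN', one_smul] at this
  rw [hm'e, eq_zero_of_mem_levelGE (Nat.lt_succ_self k) (key (k + 1)), exp_zero, mul_one]

theorem isBarycenter_iff_baryDefect (x : Fin N → freeNilpotentLieGroup d k)
    (m : freeNilpotentLieGroup d k) :
    IsBarycenter x m ↔ baryDefect (fun i => (x i : TruncTensor d k)) m = 0 := Iff.rfl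

theorem isBarycenter_iff_eq_bary (hN : 1 ≤ N) (x : Fin N → freeNilpotentLieGroup d k)
    (m : freeNilpotentLieGroup d k) : IsBarycenter x m ↔ m = bary x := by
  have hx : ∀ i, (x i : TruncTensor d k) ∈ freeNilpotentLieGroup d k := fun i => (x i).2
  have hb : IsBarycenter x (bary x) :=
    Classical.epsilon_spec (p := IsBarycenter x)
      ⟨⟨_, baryIterate_mem hN hx⟩, baryDefect_baryIterate hN hx⟩
  exact ⟨fun h => Subtype.ext (eq_of_baryDefect_eq_zero hN hx (bary x).2 m.2 hb h),
    fun h => h ▸ hb⟩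

/-- By uniqueness the chosen solution is the explicit iterate, whose polynomial form is then
available. -/
theorem coe_bary (hN : 1 ≤ N) (x : Fin N → freeNilpotentLieGroup d k) :
    (bary x : TruncTensor d k) = baryIterate fun i => (x i : TruncTensor d k) := by
  have hx : ∀ i, (x i : TruncTensor d k) ∈ freeNilpotentLieGroup d k := fun i => (x i).2
  have := (isBarycenter_iff_eq_bary hN x ⟨_, baryIterate_mem hN hx⟩).1
    (baryDefect_baryIterate hN hx)
  exact (congrArg Subtype.val this).symm

/-! ### Prescribing the barycenter -/

/-- The element that has to be put at position `i` of the sample `x` for the barycenter to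
become `y`. -/
noncomputable def baryCompletion (i : Fin N) (x : Fin N → TruncTensor d k)
    (y : TruncTensor d k) : TruncTensor d k :=
  y * exp (-∑ j ∈ Finset.univ.erase i, log (exp (-log y) * x j))

theorem baryCompletion_mem (i : Fin N) {x : Fin N → TruncTensor d k} {y : TruncTensor d k}
    (hx : ∀ i, x i ∈ freeNilpotentLieGroup d k) (hy : y ∈ freeNilpotentLieGroup d k) :
    baryCompletion i x y ∈ freeNilpotentLieGroup d k := by
  rw [baryCompletion, ← inverse_eq_exp_neg_log hy]
  exact mul_mem_group hy ⟨_, neg_mem (sum_mem fun j _ =>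
    log_mem_lieAlgebra (inverse_mul_mem_group hy (hx j))), rfl⟩

/-- Only the `i`-th summand contains `z`, so `log (y⁻¹ z)` is prescribed and `exp` recovers `z`. -/
theorem baryDefect_update_eq_zero_iff (i : Fin N) {x : Fin N → TruncTensor d k}
    {y z : TruncTensor d k} (hx : ∀ i, x i ∈ freeNilpotentLieGroup d k)
    (hy : y ∈ freeNilpotentLieGroup d k) (hz : z ∈ freeNilpotentLieGroup d k) :
    baryDefect (Function.update x i z) y = 0 ↔ z = baryCompletion i x y := by
  set c := ∑ j ∈ Finset.univ.erase i, log (Ring.inverse y * x j) with hc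
  have hcg : c ∈ freeNilpotentLieAlgebra d k :=
    sum_mem fun j _ => log_mem_lieAlgebra (inverse_mul_mem_group hy (hx j))
  have e : baryDefect (Function.update x i z) y = log (Ring.inverse y * z) + c := by
    rw [baryDefect, ← Finset.add_sum_erase _ _ (Finset.mem_univ i), Function.update_self, hc]
    congr 1
    refine Finset.sum_congr rfl fun j hj => ?_
    rw [Function.update_of_ne (Finset.ne_of_mem_erase hj)]
  have e' : baryCompletion i x y = y * exp (-c) := by
    rw [baryCompletion, ← inverse_eq_exp_neg_log hy]
  have hu := isUnit_of_mem_group hy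
  rw [e, e', add_eq_zero_iff_eq_neg]
  constructor
  · intro h
    rw [← h, exp_log_of_mem_group (inverse_mul_mem_group hy hz), ← mul_assoc,
      Ring.mul_inverse_cancel _ hu, one_mul]
  · rintro rfl
    rw [← mul_assoc, Ring.inverse_mul_cancel _ hu, one_mul,
      log_exp (lieAlgebra_le_levelGE (neg_mem hcg))]

theorem bary_update_eq_iff (hN : 1 ≤ N) (i : Fin N) (x : Fin N → freeNilpotentLieGroup d k)
    (y z : freeNilpotentLieGroup d k) :
    bary (Function.update x i z) = y ↔
      (z : TruncTensor d k) = baryCompletion i (fun j => (x j : TruncTensor d k)) y := by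
  rw [eq_comm, ← isBarycenter_iff_eq_bary hN, isBarycenter_iff_baryDefect,
    ← baryDefect_update_eq_zero_iff i (fun j => (x j).2) y.2 z.2]
  have : (fun j => (Function.update x i z j : TruncTensor d k)) =
      Function.update (fun j => (x j : TruncTensor d k)) i z := by
    funext j
    exact Function.apply_update
      (fun _ (s : freeNilpotentLieGroup d k) => (s : TruncTensor d k)) x i z j
  rw [this]

/-! ### Algebras of functions with values in the truncated tensor algebra -/

section FunctionAlgebra

variable {X : Type*} (A : Subalgebra ℝ (X → TruncTensor d k)) {f : X → TruncTensor d k}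

/-- Keeping `A` arbitrary lets one argument serve both non-commutative polynomials and polynomial
tensor entries. -/
theorem series_mem_subalgebra (c : ℕ → ℝ) (hf : f ∈ A) : (fun x => series c (f x)) ∈ A := by
  have e : (fun x => series c (f x)) = ∑ n ∈ Finset.range (k + 1), c n • f ^ n := by
    funext x
    simp [series]
  rw [e]
  exact sum_mem fun n _ => A.smul_mem (A.pow_mem hf n) _

theorem exp_mem_subalgebra (hf : f ∈ A) : (fun x => exp (f x)) ∈ A :=
  series_mem_subalgebra A _ hf

theorem log_mem_subalgebra (hf : f ∈ A) : (fun x => log (f x)) ∈ A := by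
  simp only [log_eq_series]
  exact series_mem_subalgebra A _ (A.sub_mem hf A.one_mem)

theorem log_exp_neg_log_mul_mem_subalgebra {g : X → TruncTensor d k} (hf : f ∈ A) (hg : g ∈ A) :
    (fun x => log (exp (-log (f x)) * g x)) ∈ A :=
  log_mem_subalgebra A
    (A.mul_mem (exp_mem_subalgebra A (A.neg_mem (log_mem_subalgebra A hf))) hg)

theorem sum_log_mem_subalgebra (s : Finset (Fin N)) {g : Fin N → X → TruncTensor d k}
    (hf : f ∈ A) (hg : ∀ i, g i ∈ A) :
    (fun x => ∑ i ∈ s, log (exp (-log (f x)) * g i x)) ∈ A := by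
  have e : (fun x => ∑ i ∈ s, log (exp (-log (f x)) * g i x)) =
      ∑ i ∈ s, fun x => log (exp (-log (f x)) * g i x) := by
    funext x
    simp
  rw [e]
  exact sum_mem fun i _ => log_exp_neg_log_mul_mem_subalgebra A hf (hg i)

theorem baryIterate_mem_subalgebra {g : Fin N → X → TruncTensor d k} (hg : ∀ i, g i ∈ A) :
    (fun x => baryIterate fun i => g i x) ∈ A := by
  have key : ∀ n, (fun x => (baryStep fun i => g i x)^[n] 1) ∈ A := by
    intro n
    induction n with
    | zero => exact A.one_mem
    | succ n ih =>
      simp only [Function.iterate_succ_apply']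
      exact A.mul_mem ih
        (exp_mem_subalgebra A (A.smul_mem (sum_log_mem_subalgebra A Finset.univ ih hg) _))
  exact key k

theorem baryCompletion_mem_subalgebra (i : Fin N) {g : Fin N → X → TruncTensor d k} (hf : f ∈ A)
    (hg : ∀ i, g i ∈ A) : (fun x => baryCompletion i (fun i => g i x) (f x)) ∈ A :=
  A.mul_mem hf (exp_mem_subalgebra A (A.neg_mem (sum_log_mem_subalgebra A _ hf hg)))

/-- The maps to the truncated tensor algebra whose tensor entries are polynomials in the
coordinates `c`. -/
noncomputable def polynomialMaps (d k : ℕ) {X σ : Type*} (c : X → σ → ℝ) :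
    Subalgebra ℝ (X → TruncTensor d k) where
  carrier := {f | ∀ w, ∃ p : MvPolynomial σ ℝ, ∀ x, (f x).coeff w = MvPolynomial.eval (c x) p}
  mul_mem' := fun {f g} hf hg w => by
    choose p hp using hf
    choose q hq using hg
    exact ⟨∑ i ∈ Finset.range (w.1.length + 1), p (pre w i) * q (suf w i),
      fun x => by simp [coeff_mul, hp, hq]⟩
  add_mem' := fun {f g} hf hg w => by
    obtain ⟨p, hp⟩ := hf w
    obtain ⟨q, hq⟩ := hg w
    exact ⟨p + q, fun x => by simp [hp, hq]⟩
  algebraMap_mem' := fun r w =>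
    ⟨MvPolynomial.C ((algebraMap ℝ (TruncTensor d k) r).coeff w), fun x => by simp⟩

theorem mem_polynomialMaps {σ : Type*} {c : X → σ → ℝ} :
    f ∈ polynomialMaps d k c ↔
      ∀ w, ∃ p : MvPolynomial σ ℝ, ∀ x, (f x).coeff w = MvPolynomial.eval (c x) p := Iff.rfl

theorem const_mem_polynomialMaps {σ : Type*} (c : X → σ → ℝ) (s : TruncTensor d k) :
    (fun _ => s) ∈ polynomialMaps d k c :=
  fun w => ⟨MvPolynomial.C (s.coeff w), fun _ => by simp⟩

theorem isVarietyMorphism_iff {σ : Type*} (c : X → σ → ℝ) (f : X → freeNilpotentLieGroup d k) :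
    IsVarietyMorphism c (groupCoord d k) f ↔
      (fun x => (f x : TruncTensor d k)) ∈ polynomialMaps d k c := by
  rw [mem_polynomialMaps]
  constructor
  · rintro ⟨P, hP⟩ w
    exact ⟨P w, fun x => hP x w⟩
  · intro h
    choose P hP using h
    exact ⟨P, fun x w => hP w x⟩

end FunctionAlgebra

theorem coe_mem_polynomialMaps :
    (fun z : freeNilpotentLieGroup d k => (z : TruncTensor d k)) ∈
      polynomialMaps d k (groupCoord d k) :=
  fun w => ⟨MvPolynomial.X w, fun x => by simp [groupCoord]⟩

/-! ### Noncommutative polynomials -/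

theorem coeff_sum {ι : Type*} (s : Finset ι) (f : ι → TruncTensor d k) (w : Word d k) :
    (∑ i ∈ s, f i).coeff w = ∑ i ∈ s, (f i).coeff w := by
  have h := congrFun (map_sum (coeffHom d k) f s) w
  rw [Finset.sum_apply] at h
  exact h

/-- This is why no symbol for level `0` is needed. -/
theorem eq_one_add_sum_level {s : TruncTensor d k} (hs : s - 1 ∈ levelGE d k 1) :
    s = 1 + ∑ j : Fin k, level (j + 1) s := by
  ext w : 2
  rw [coeff_add, coeff_one, coeff_sum]
  simp only [level]
  rcases Nat.eq_zero_or_pos w.1.length with h | h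
  · have h1 := hs w (by omega)
    rw [sub_eq_add_neg, ← neg_one_smul ℝ, coeff_add, coeff_smul, coeff_one] at h1
    have hw := List.length_eq_zero_iff.1 h
    simp only [hw, if_true] at h1 ⊢
    simp
    linarith
  · have hw : w.1 ≠ [] := fun h' => by simp [h'] at h
    have hlt : w.1.length - 1 < k := by have := w.2; omega
    rw [if_neg hw, zero_add, Finset.sum_eq_single (⟨w.1.length - 1, hlt⟩ : Fin k)]
    · rw [if_pos]; dsimp only; omega
    · intro j _ hj
      rw [if_neg]
      intro h'
      exact hj (Fin.ext (by dsimp only; omega))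
    · simp

theorem exists_ncEval_eq_bary (hN : 1 ≤ N) :
    ∃ q : NCPoly k N, ∀ x : Fin N → freeNilpotentLieGroup d k,
      (bary x : TruncTensor d k) = ncEval q (fun i => (x i : TruncTensor d k)) := by
  -- The range of `Φ` is the subalgebra of functions represented by non-commutative polynomials.
  let Φ : NCPoly k N →ₐ[ℝ] ((Fin N → freeNilpotentLieGroup d k) → TruncTensor d k) :=
    FreeAlgebra.lift ℝ fun p x => level (p.2 + 1) (x p.1 : TruncTensor d k)
  have hΦ : ∀ q x, Φ q x = ncEval q (fun i => (x i : TruncTensor d k)) := by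
    intro q x
    have : (Pi.evalAlgHom ℝ (fun _ => TruncTensor d k) x).comp Φ =
        FreeAlgebra.lift ℝ (fun p : Fin N × Fin k => level (p.2 + 1) (x p.1 : TruncTensor d k)) := by
      ext p : 2
      simp [Φ]
    exact DFunLike.congr_fun this q
  have hx : ∀ i, (fun x : Fin N → freeNilpotentLieGroup d k => (x i : TruncTensor d k)) ∈
      Φ.range := by
    intro i
    refine ⟨1 + ∑ j : Fin k, FreeAlgebra.ι ℝ (i, j), ?_⟩
    funext x
    rw [eq_one_add_sum_level (sub_one_mem_of_mem_group (x i).2)]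
    simp [Φ]
  obtain ⟨q, hq⟩ := baryIterate_mem_subalgebra Φ.range hx
  refine ⟨q, fun x => ?_⟩
  rw [coe_bary hN, ← hΦ]
  exact (congrFun hq x).symm

/-! ### The group as an affine variety -/

instance : Finite (Word d k) := (List.finite_length_le (Fin d) k).to_subtype

/-- The tensor sequence with a single nonzero entry, equal to `1`, at the word `w`. -/
noncomputable def wordVec (w : Word d k) : TruncTensor d k :=
  open Classical in ⟨fun v => if v = w then 1 else 0⟩

theorem exists_eval_eq_functional {X σ : Type*} {c : X → σ → ℝ} {f : X → TruncTensor d k}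
    (hf : f ∈ polynomialMaps d k c) (φ : TruncTensor d k →ₗ[ℝ] ℝ) :
    ∃ p : MvPolynomial σ ℝ, ∀ x, φ (f x) = MvPolynomial.eval (c x) p := by
  have := Fintype.ofFinite (Word d k)
  choose P hP using hf
  refine ⟨∑ w, MvPolynomial.C (φ (wordVec w)) * P w, fun x => ?_⟩
  have e : f x = ∑ w, (f x).coeff w • wordVec w := by
    ext v : 2
    rw [coeff_sum]
    simp [wordVec]
  rw [e, map_sum, map_sum]
  refine Finset.sum_congr rfl fun w _ => ?_
  rw [map_smul, map_mul, MvPolynomial.eval_C, ← hP, smul_eq_mul, mul_comm]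

theorem isAffineVariety_group : IsAffineVariety (Set.range (groupCoord d k)) := by
  refine ⟨{p | ∀ s : freeNilpotentLieGroup d k, MvPolynomial.eval (groupCoord d k s) p = 0},
    Set.Subset.antisymm ?_ ?_⟩
  · rintro _ ⟨s, rfl⟩ p hp
    exact hp s
  · intro a ha
    have hid : (fun b : Word d k → ℝ => (⟨b⟩ : TruncTensor d k)) ∈ polynomialMaps d k id :=
      fun w => ⟨MvPolynomial.X w, fun b => by simp⟩
    have hlog := log_mem_subalgebra _ hid
    -- Each entry is a polynomial in `a` that vanishes on the group, hence at `a`.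
    have h1 : exp (log ⟨a⟩) - ⟨a⟩ = (0 : TruncTensor d k) := by
      ext w : 2
      obtain ⟨p, hp⟩ := (polynomialMaps d k id).sub_mem (exp_mem_subalgebra _ hlog) hid w
      have : MvPolynomial.eval a p = 0 := ha p fun s => by
        have := hp (groupCoord d k s)
        rw [id] at this
        rw [← this]
        have e : (⟨groupCoord d k s⟩ : TruncTensor d k) = s := rfl
        simp only [Pi.sub_apply, e, exp_log_of_mem_group s.2, sub_self, coeff_zero]
      rw [coeff_zero, ← this]
      exact hp a
    -- Otherwise some functional vanishes on the Lie algebra but not at `log a`; composed with `log`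
    -- it is a polynomial vanishing on the group.
    have h2 : log ⟨a⟩ ∈ (freeNilpotentLieAlgebra d k).toSubmodule := by
      by_contra hn
      obtain ⟨φ, hφ, hker⟩ := Submodule.exists_le_ker_of_notMem hn
      obtain ⟨p, hp⟩ := exists_eval_eq_functional hlog φ
      refine hφ ((hp a).trans (ha p fun s => ?_))
      exact (hp (groupCoord d k s)).symm.trans (hker (log_mem_lieAlgebra s.2))
    exact ⟨⟨⟨a⟩, log ⟨a⟩, h2, sub_eq_zero.1 h1⟩, rfl⟩

/-! ### The barycenter map as a morphism -/

theorem isVarietyMorphism_bary (hN : 1 ≤ N) :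
    IsVarietyMorphism (sampleCoord d k N) (groupCoord d k)
      (bary : (Fin N → freeNilpotentLieGroup d k) → freeNilpotentLieGroup d k) := by
  rw [isVarietyMorphism_iff]
  simp only [coe_bary hN]
  exact baryIterate_mem_subalgebra _ fun i w =>
    ⟨MvPolynomial.X (i, w), fun x => by simp [sampleCoord, groupCoord]⟩

theorem isVarietyIso_bary_update (hN : 1 ≤ N) (i : Fin N)
    (x : Fin N → freeNilpotentLieGroup d k) :
    IsVarietyIso (groupCoord d k) (groupCoord d k)
      (fun z : freeNilpotentLieGroup d k => bary (Function.update x i z)) := by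
  refine ⟨?_, fun y => ⟨_, baryCompletion_mem i (fun j => (x j).2) y.2⟩, ?_, ?_, ?_⟩
  · rw [isVarietyMorphism_iff]
    simp only [coe_bary hN]
    refine baryIterate_mem_subalgebra _ fun j => ?_
    rcases eq_or_ne j i with rfl | hj
    · simpa only [Function.update_self] using coe_mem_polynomialMaps
    · simpa only [Function.update_of_ne hj] using const_mem_polynomialMaps _ _
  · rw [isVarietyMorphism_iff]
    exact baryCompletion_mem_subalgebra _ i coe_mem_polynomialMaps
      fun j => const_mem_polynomialMaps _ _
  · intro z
    exact Subtype.ext ((bary_update_eq_iff hN i x _ z).1 rfl).symm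
  · intro y
    exact (bary_update_eq_iff hN i x y _).2 rfl

end TruncTensor

open TruncTensor
theorem mainTheorem2 (d k N : ℕ) (hN : 1 ≤ N) :
    -- the free nilpotent Lie group is an affine variety
    IsAffineVariety (Set.range (groupCoord d k)) ∧
    -- every sample has a unique barycenter, so that `bary` is the barycenter map
    (∀ (x : Fin N → freeNilpotentLieGroup d k) (m : freeNilpotentLieGroup d k),
      IsBarycenter x m ↔ m = bary x) ∧
    -- the barycenter map is represented by a non-commutative polynomial
    (∃ q : NCPoly k N, ∀ x : Fin N → freeNilpotentLieGroup d k,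
      (bary x : TruncTensor d k) = ncEval q (fun i => (x i : TruncTensor d k))) ∧
    -- it is a surjective morphism of affine varieties
    IsVarietyMorphism (sampleCoord d k N) (groupCoord d k)
      (bary : (Fin N → freeNilpotentLieGroup d k) → freeNilpotentLieGroup d k) ∧
    Function.Surjective
      (bary : (Fin N → freeNilpotentLieGroup d k) → freeNilpotentLieGroup d k) ∧
    -- with all sample elements but the `i`-th fixed, it is an isomorphism of affine varieties
    (∀ (i : Fin N) (x : Fin N → freeNilpotentLieGroup d k),
      IsVarietyIso (groupCoord d k) (groupCoord d k)
        (fun z : freeNilpotentLieGroup d k => bary (Function.update x i z))) ∧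
    -- every element is a barycenter with all sample elements but the `i`-th prescribed
    (∀ (i : Fin N) (x : Fin N → freeNilpotentLieGroup d k) (y : freeNilpotentLieGroup d k),
      ∃! z : freeNilpotentLieGroup d k, bary (Function.update x i z) = y) := by
  have hu : ∀ (i : Fin N) (x : Fin N → freeNilpotentLieGroup d k) (y : freeNilpotentLieGroup d k),
      ∃! z : freeNilpotentLieGroup d k, bary (Function.update x i z) = y := fun i x y =>
    ⟨⟨_, baryCompletion_mem i (fun j => (x j).2) y.2⟩, (bary_update_eq_iff hN i x y _).2 rfl,
      fun z hz => Subtype.ext ((bary_update_eq_iff hN i x y z).1 hz)⟩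
  refine ⟨isAffineVariety_group, isBarycenter_iff_eq_bary hN, exists_ncEval_eq_bary hN,
    isVarietyMorphism_bary hN, fun y => ?_, isVarietyIso_bary_update hN, hu⟩
  -- Since `1 ≤ N`, slot `0` exists and can be solved for; the other entries are arbitrary.
  obtain ⟨z, hz, -⟩ := hu ⟨0, hN⟩ (fun _ => y) y
  exact ⟨_, hz⟩
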